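/- Let $d\ge 0$ and $n\ge 1$ be integers, let $\Gamma\subset\mathbb{Z}^d$ be a finite non-empty set with $|\Gamma|=D$, and let $x_1,\dots,x_n$ be independent random variables, each uniformly distributed on $[0,1]^d$. Let $U\in\mathbb{C}^{n\times D}$ be the random Fourier matrix with entries $u_{tk}=e^{2\pi i k\cdot x_t}$, $t=1,\dots,n$, $k\in\Gamma$. For integers $m,k\ge 1$ let $S_2(m,k)$ be the associated Stirling number of the second kind, i.e. the number of partitions of an $m$-element set into exactly $k$ blocks each having at least two elements, and put $$F_m(z)=\sum_{k=1}^{\lfloor m/2\rfloor}S_2(m,k)\,z^k,\qquad G_m(z)=z^{-m}F_m(z).$$ Then for every $\varepsilon>0$ and every integer $m\ge 1$, with probability at least $$1-\varepsilon^{-2m}\,D\,G_{2m}(n/D)$$ we have $$\bigl\Vert n^{-1}U^*U-I\bigr\Vert<\varepsilon$$ and hence also $$1-\varepsilon<\lambda_{\min}(n^{-1}U^*U)\le\lambda_{\max}(n^{-1}U^*U)<1+\varepsilon .$$ Here $\Vert\cdot\Vert$ is the operator norm with respect to the Euclidean norm on $\mathbb{C}^D$, and $\lambda_{\min}$, $\lambda_{\max}$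 denote the smallest and largest eigenvalue of a Hermitian matrix. -/

import Mathlib

open scoped Matrix Matrix.Norms.L2Operator

/-- The associated Stirling number of the second kind `S₂(m, k)`: the number of partitions of an
`m`-element set into exactly `k` blocks, each block having at least two elements. -/
def assocStirling (m k : ℕ) : ℕ :=
  Fintype.card {P : Finpartition (Finset.univ : Finset (Fin m)) //
    P.parts.card = k ∧ ∀ b ∈ P.parts, 2 ≤ b.card}

/-- The polynomial `F_m(z) = ∑_{k=1}^{⌊m/2⌋} S₂(m, k) z^k`. -/
noncomputable def stirlingF (m : ℕ) : Polynomial ℝ :=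
  ∑ k ∈ Finset.Icc 1 (m / 2), Polynomial.C (assocStirling m k : ℝ) * Polynomial.X ^ k

/-- `G_m(z) = z^{-m} F_m(z)`. -/
noncomputable def stirlingG (m : ℕ) (z : ℝ) : ℝ :=
  z ^ (-(m : ℤ)) * (stirlingF m).eval z

/-- The Fourier matrix `u_{tk} = e^{2πi k·x_t}`, `k ∈ Γ`, `t = 1, …, n`. -/
noncomputable def fourierMatrix {d n : ℕ} (Γ : Finset (Fin d → ℤ)) (x : Fin n → Fin d → ℝ) :
    Matrix (Fin n) Γ ℂ :=
  Matrix.of fun t k =>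
    Complex.exp (2 * Real.pi * Complex.I * ∑ i, ((k : Fin d → ℤ) i : ℂ) * (x t i : ℂ))

/-- The sample second moment matrix `n⁻¹ U* U`. -/
noncomputable def sampleMoment {d n : ℕ} (Γ : Finset (Fin d → ℤ)) (x : Fin n → Fin d → ℝ) :
    Matrix Γ Γ ℂ :=
  (n : ℂ)⁻¹ • ((fourierMatrix Γ x)ᴴ * fourierMatrix Γ x)

theorem sampleMoment_isHermitian {d n : ℕ} (Γ : Finset (Fin d → ℤ)) (x : Fin n → Fin d → ℝ) :
    (sampleMoment Γ x).IsHermitian := by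
  simp [sampleMoment, Matrix.IsHermitian, Matrix.conjTranspose_smul, Matrix.conjTranspose_mul]

/-- The minimal eigenvalue of a hermitian matrix. -/
noncomputable def lambdaMin {ι : Type*} [Fintype ι] [DecidableEq ι] [Nonempty ι]
    {A : Matrix ι ι ℂ} (hA : A.IsHermitian) : ℝ :=
  Finset.univ.inf' Finset.univ_nonempty hA.eigenvalues

/-- The maximal eigenvalue of a hermitian matrix. -/
noncomputable def lambdaMax {ι : Type*} [Fintype ι] [DecidableEq ι] [Nonempty ι]
    {A : Matrix ι ι ℂ} (hA : A.IsHermitian) : ℝ :=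
  Finset.univ.sup' Finset.univ_nonempty hA.eigenvalues

/-! ### Traces, norms and eigenvalues of Hermitian matrices -/

section HermitianMatrices

variable {ι : Type*} [Fintype ι] [DecidableEq ι]

/-! The proof is by the method of moments. Put `A = n⁻¹ U* U - 1`. Since `A` is Hermitian, `‖A‖ ^
(2m) ≤ tr A ^ (2m)`, so Markov's inequality reduces the claim to `E tr A ^ (2m) ≤ D G_{2m}(n/D)`.

The diagonal of `A` vanishes. Hence the trace is a sum over closed paths in `Γ` without stationary
steps and, once each entry is expanded, over labellings of the steps by samples. By independence and
orthogonality of characters, such a pair has mean `n^(-2m)` if the increments of the path sum to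
zero over every fibre of the labelling, and mean 0 otherwise (`integral_trace_sampleMoment`).

It remains to count balanced pairs (`sum_card_balancedPaths_le`). The fibres partition the steps
into `k` blocks, none a singleton, which gives `S₂(2m, k)`. A partition admits at most `n^k`
labellings. The `k` block equations add up to closedness, so closedness and `k - 1` of them leave at
most `D^(2m+1-k)` paths (`card_closed_paths_le`). -/

theorem Matrix.IsHermitian.trace_pow_eq_sum_eigenvalues {A : Matrix ι ι ℂ} (hA : A.IsHermitian)
    (N : ℕ) : (A ^ N).trace = ∑ i, (hA.eigenvalues i : ℂ) ^ N := by
  conv_lhs => rw [hA.spectral_theorem, ← map_pow, Unitary.conjStarAlgAut_apply,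
    Matrix.trace_mul_comm, ← mul_assoc, Unitary.coe_star_mul_self, one_mul, Matrix.diagonal_pow,
    Matrix.trace_diagonal]
  simp

/-- An even trace moment of a Hermitian matrix dominates the same power of its operator norm. -/
theorem Matrix.IsHermitian.norm_pow_le_re_trace_pow [Nonempty ι] {A : Matrix ι ι ℂ}
    (hA : A.IsHermitian) (m : ℕ) : ‖A‖ ^ (2 * m) ≤ ((A ^ (2 * m)).trace).re := by
  -- The norm of a self-adjoint matrix is its spectral radius, attained at some eigenvalue; the even
  -- powers of the other eigenvalues are nonnegative.
  obtain ⟨z, hz, hzn⟩ := spectrum.exists_nnnorm_eq_spectralRadius A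
  have hA' : IsSelfAdjoint A := hA
  rw [hA'.spectralRadius_eq_nnnorm] at hzn
  have hznn : ‖z‖₊ = ‖A‖₊ := by exact_mod_cast hzn
  have hzn' : ‖z‖ = ‖A‖ := by rw [← coe_nnnorm, hznn, coe_nnnorm]
  rw [hA.spectrum_eq_image_range] at hz
  obtain ⟨_, ⟨i, rfl⟩, rfl⟩ := hz
  have hre : ((A ^ (2 * m)).trace).re = ∑ j, hA.eigenvalues j ^ (2 * m) := by
    rw [hA.trace_pow_eq_sum_eigenvalues, Complex.re_sum]
    exact Finset.sum_congr rfl fun j _ => by rw [← Complex.ofReal_pow, Complex.ofReal_re]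
  rw [hre, ← hzn']
  have h1 : ‖((hA.eigenvalues i : ℝ) : ℂ)‖ ^ (2 * m) = hA.eigenvalues i ^ (2 * m) := by
    rw [Complex.norm_real, Real.norm_eq_abs, pow_mul, sq_abs, ← pow_mul]
  refine h1.le.trans ?_
  exact Finset.single_le_sum (f := fun j => hA.eigenvalues j ^ (2 * m))
    (fun j _ => by rw [pow_mul]; positivity) (Finset.mem_univ i)

theorem Matrix.IsHermitian.abs_eigenvalues_sub_one_le {A : Matrix ι ι ℂ} (hA : A.IsHermitian)
    (i : ι) : |hA.eigenvalues i - 1| ≤ ‖A - 1‖ := by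
  have : Nonempty ι := ⟨i⟩
  have h : (hA.eigenvalues i : ℂ) ∈ spectrum ℂ A := by
    rw [hA.spectrum_eq_image_range]
    exact ⟨_, ⟨i, rfl⟩, rfl⟩
  have h2 : (hA.eigenvalues i : ℂ) - 1 ∈ spectrum ℂ (A - 1) := by
    have h3 := (spectrum.add_mem_add_iff (s := (-1 : ℂ))).2 h
    simpa [sub_eq_add_neg, add_comm] using h3
  have h4 := spectrum.norm_le_norm_of_mem h2
  rwa [← Complex.ofReal_one, ← Complex.ofReal_sub, Complex.norm_real, Real.norm_eq_abs] at h4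

theorem lambdaMin_le_lambdaMax [Nonempty ι] {A : Matrix ι ι ℂ} (hA : A.IsHermitian) :
    lambdaMin hA ≤ lambdaMax hA :=
  let i : ι := Classical.arbitrary ι
  (Finset.inf'_le _ (Finset.mem_univ i)).trans (Finset.le_sup' _ (Finset.mem_univ i))

theorem one_sub_lt_lambdaMin [Nonempty ι] {A : Matrix ι ι ℂ} (hA : A.IsHermitian) {ε : ℝ}
    (h : ‖A - 1‖ < ε) : 1 - ε < lambdaMin hA := by
  rw [lambdaMin, Finset.lt_inf'_iff]
  intro i _
  linarith [(abs_lt.1 ((hA.abs_eigenvalues_sub_one_le i).trans_lt h)).1]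

theorem lambdaMax_lt_one_add [Nonempty ι] {A : Matrix ι ι ℂ} (hA : A.IsHermitian) {ε : ℝ}
    (h : ‖A - 1‖ < ε) : lambdaMax hA < 1 + ε := by
  rw [lambdaMax, Finset.sup'_lt_iff]
  intro i _
  linarith [(abs_lt.1 ((hA.abs_eigenvalues_sub_one_le i).trans_lt h)).2]

/-- Powers of a matrix as sums over paths, weighted at both ends. -/
theorem Matrix.sum_paths_eq_dotProduct_pow_mulVec {R : Type*} [CommRing R] (A : Matrix ι ι R)
    (N : ℕ) (f g : ι → R) :
    ∑ p : Fin (N + 1) → ι, f (p 0) * (∏ i : Fin N, A (p i.castSucc) (p i.succ)) * g (p (Fin.last N))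
      = f ⬝ᵥ (A ^ N *ᵥ g) := by
  induction N generalizing f with
  | zero =>
    rw [← (Equiv.funUnique (Fin 1) ι).symm.sum_comp]
    simp [dotProduct, Equiv.funUnique]
  | succ N ih =>
    -- The first step of the path is absorbed into the left weight, which is why the induction
    -- generalizes `f`.
    have key : f ⬝ᵥ (A ^ (N + 1) *ᵥ g) = (f ᵥ* A) ⬝ᵥ (A ^ N *ᵥ g) := by
      rw [pow_succ', ← Matrix.mulVec_mulVec, Matrix.dotProduct_mulVec]
    rw [key, ← ih, ← (Fin.consEquiv fun _ : Fin (N + 2) => ι).sum_comp, Fintype.sum_prod_type,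
      Finset.sum_comm]
    refine Finset.sum_congr rfl fun p _ => ?_
    simp only [Fin.consEquiv, Equiv.coe_fn_mk, Fin.prod_univ_succ, Fin.cons_zero, Fin.castSucc_zero,
      Fin.cons_succ, ← Fin.succ_castSucc, ← Fin.succ_last, Matrix.vecMul, dotProduct,
      Finset.sum_mul]
    exact Finset.sum_congr rfl fun j _ => by ring

theorem Matrix.trace_pow_eq_sum_closed_paths {R : Type*} [CommRing R] (A : Matrix ι ι R) (N : ℕ) :
    (A ^ N).trace = ∑ p : Fin (N + 1) → ι with p 0 = p (Fin.last N),
      ∏ i : Fin N, A (p i.castSucc) (p i.succ) := by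
  -- Indicator weights at both ends pick out a diagonal entry; summing over `j` leaves exactly the
  -- closed paths.
  have h : ∀ j, (A ^ N) j j = ∑ p : Fin (N + 1) → ι,
      (Pi.single j 1 : ι → R) (p 0) * (∏ i : Fin N, A (p i.castSucc) (p i.succ)) *
        (Pi.single j 1 : ι → R) (p (Fin.last N)) := fun j => by
    rw [Matrix.sum_paths_eq_dotProduct_pow_mulVec]
    simp
  simp only [Matrix.trace, Matrix.diag, h]
  rw [Finset.sum_comm, Finset.sum_filter]
  refine Finset.sum_congr rfl fun p _ => ?_
  simp only [Pi.single_apply, ite_mul, one_mul, zero_mul, mul_ite, mul_one, mul_zero]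
  split_ifs with hp
  · simp [hp]
  · refine Finset.sum_eq_zero fun j _ => ?_
    split_ifs with h1 h2
    · exact absurd (h2.trans h1.symm) hp
    · rfl
    · rfl

end HermitianMatrices

/-! ### Counting balanced paths and labellings -/

section Counting

open Finset

/-- A closed path in `Γ` whose increments sum to zero over each block of a partition of the steps is
determined by its positions off the first elements of the blocks not containing the first step. -/
theorem card_closed_paths_le {V : Type*} [AddCommGroup V] [DecidableEq V] (Γ : Finset V) {M : ℕ}
    (hM : 0 < M) (hΓ : Γ.Nonempty) (P : Finpartition (univ : Finset (Fin M))) :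
    #{p : Fin (M + 1) → Γ | p 0 = p (Fin.last M) ∧
      ∀ b ∈ P.parts, ∑ i ∈ b, ((p i.succ : V) - p i.castSucc) = 0} ≤ #Γ ^ (M + 1 - #P.parts) := by
  classical
  let o : Fin M := ⟨0, hM⟩
  -- The dependent positions: the minimum of each block except the block of step 0. That block is
  -- spared because closedness recovers the endpoint from position 0, which must therefore stay
  -- free.
  let T : Finset (Fin M) := {i | P.part o ≠ P.part i ∧ ∀ j ∈ P.part i, i ≤ j}
  have hTcard : #P.parts ≤ #T + 1 := by
    have hsub : P.parts.erase (P.part o) ⊆ T.image P.part := by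
      intro b hb
      obtain ⟨hb0, hb⟩ := mem_erase.1 hb
      have hne := P.nonempty_of_mem_parts hb
      have hpart : P.part (b.min' hne) = b := P.part_eq_of_mem hb (b.min'_mem hne)
      refine mem_image.2 ⟨b.min' hne, ?_, hpart⟩
      simp only [T, mem_filter, mem_univ, true_and, hpart]
      exact ⟨hb0.symm, fun j hj => b.min'_le j hj⟩
    have h1 := (card_le_card hsub).trans card_image_le
    rw [card_erase_of_mem (P.part_mem.2 (mem_univ o))] at h1
    omega
  have hcompl : Fintype.card {i // i ∉ T} ≤ M + 1 - #P.parts := by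
    have h2 : Fintype.card {i // i ∉ T} = M - #T := by
      rw [Fintype.card_subtype_compl, Fintype.card_fin, Fintype.card_coe]
    omega
  refine le_trans ?_ (Nat.pow_le_pow_right hΓ.card_pos hcompl)
  have hcod : #(univ : Finset ({i // i ∉ T} → Γ)) = #Γ ^ Fintype.card {i // i ∉ T} := by
    rw [card_univ, Fintype.card_fun, Fintype.card_coe]
  rw [← hcod]
  refine card_le_card_of_injOn (fun p i => p i.1.castSucc) (fun _ _ => mem_coe.2 (mem_univ _)) ?_
  intro p hp q hq hpq
  simp only [coe_filter, mem_univ, true_and, Set.mem_ofPred_eq] at hp hq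
  have hoff : ∀ i, i ∉ T → p i.castSucc = q i.castSucc := fun i hi => congrFun hpq ⟨i, hi⟩
  have hoT : o ∉ T := by simp [T]
  have h0 : (0 : Fin (M + 1)) = o.castSucc := rfl
  -- Downward induction on the position. If `j` is the minimum of its block, the later endpoints of
  -- all steps in the block are already known, and the other starting points lie off `T`; the block
  -- equation then determines position `j`.
  have main : ∀ i : Fin (M + 1), p i = q i := by
    intro i
    induction i using WellFoundedGT.induction with
    | ind i ih =>
    induction i using Fin.lastCases with
    | last => rw [← hp.1, ← hq.1, h0, hoff o hoT]
    | cast j =>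
      by_cases hj : j ∈ T
      · have hb : P.part j ∈ P.parts := P.part_mem.2 (mem_univ j)
        have hjT := (mem_filter.1 hj).2
        have hs : ∀ l ∈ P.part j, p l.succ = q l.succ := fun l hl =>
          ih _ (Fin.castSucc_lt_succ_iff.2 (hjT.2 l hl))
        have hl : ∀ l ∈ P.part j, l ≠ j → p l.castSucc = q l.castSucc := by
          intro l hl hne
          refine hoff l fun hlT => hne ?_
          have hpl : P.part l = P.part j := P.part_eq_of_mem hb hl
          have h3 := (mem_filter.1 hlT).2.2 j (by rw [hpl]; exact P.mem_part_self.2 (mem_univ j))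
          exact le_antisymm h3 (hjT.2 l hl)
        have h5 : ∑ l ∈ P.part j, ((p l.castSucc : V) - q l.castSucc) = 0 := by
          have e1 := hp.2 _ hb
          have e2 := hq.2 _ hb
          rw [sum_sub_distrib, sub_eq_zero] at e1 e2
          rw [sum_sub_distrib, sub_eq_zero, ← e1, ← e2]
          exact sum_congr rfl fun l hl' => by rw [hs l hl']
        rw [sum_eq_single_of_mem j (P.mem_part_self.2 (mem_univ j))
          (fun l hl' hne => by rw [hl l hl' hne, sub_self]), sub_eq_zero] at h5
        exact Subtype.ext h5
      · exact hoff j hj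
  exact funext main

/-- A labelling constant on blocks is determined by its values at the block minima. -/
theorem card_labelings_le {M n : ℕ} (P : Finpartition (univ : Finset (Fin M))) :
    #{t : Fin M → Fin n | ∀ i j, P.part i = P.part j → t i = t j} ≤ n ^ #P.parts := by
  classical
  have hcod : #(univ : Finset (P.parts → Fin n)) = n ^ #P.parts := by
    rw [card_univ, Fintype.card_fun, Fintype.card_coe, Fintype.card_fin]
  rw [← hcod]
  refine card_le_card_of_injOn (fun t b => t (b.1.min' (P.nonempty_of_mem_parts b.2)))
    (fun _ _ => mem_coe.2 (mem_univ _)) ?_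
  intro t ht u hu htu
  simp only [coe_filter, mem_univ, true_and, Set.mem_ofPred_eq] at ht hu
  funext i
  have hb : P.part i ∈ P.parts := P.part_mem.2 (mem_univ i)
  have hpart : P.part i = P.part ((P.part i).min' (P.nonempty_of_mem_parts hb)) :=
    (P.part_eq_of_mem hb (min'_mem _ _)).symm
  rw [ht _ _ hpart, hu _ _ hpart]
  exact congrFun htu ⟨P.part i, hb⟩

/-- The closed paths in `Γ` without stationary steps whose increments sum to zero over each fibre
of the labelling `t` of the steps. -/
def balancedPaths {V : Type*} [AddCommGroup V] [DecidableEq V] (Γ : Finset V) {M n : ℕ}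
    (t : Fin M → Fin n) : Finset (Fin (M + 1) → Γ) :=
  {p | (p 0 = p (Fin.last M) ∧ ∀ i : Fin M, p i.castSucc ≠ p i.succ) ∧
    ∀ s, ∑ i with t i = s, ((p i.succ : V) - p i.castSucc) = 0}

open Classical in
/-- The partition of the steps into the nonempty fibres of a labelling. -/
noncomputable def fibrePartition {M n : ℕ} (t : Fin M → Fin n) :
    Finpartition (univ : Finset (Fin M)) :=
  Finpartition.ofSetoid (Setoid.ker t)

theorem part_fibrePartition {M n : ℕ} (t : Fin M → Fin n) (i : Fin M) :
    (fibrePartition t).part i = ({j | t j = t i} : Finset (Fin M)) := by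
  classical
  ext j
  rw [fibrePartition, Finpartition.mem_part_ofSetoid_iff_rel]
  simp [eq_comm]

theorem mem_parts_fibrePartition {M n : ℕ} (t : Fin M → Fin n) {b : Finset (Fin M)}
    (hb : b ∈ (fibrePartition t).parts) :
    ∃ i, b = ({j | t j = t i} : Finset (Fin M)) := by
  obtain ⟨i, hi⟩ := Finpartition.nonempty_of_mem_parts _ hb
  exact ⟨i, by rw [← part_fibrePartition, Finpartition.part_eq_of_mem _ hb hi]⟩

theorem card_balancedPaths_le {V : Type*} [AddCommGroup V] [DecidableEq V] (Γ : Finset V) {M n : ℕ}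
    (hM : 0 < M) (hΓ : Γ.Nonempty) (t : Fin M → Fin n) :
    #(balancedPaths Γ t) ≤ #Γ ^ (M + 1 - #(fibrePartition t).parts) := by
  refine le_trans (card_le_card ?_) (card_closed_paths_le Γ hM hΓ _)
  intro p hp
  simp only [balancedPaths, mem_filter, mem_univ, true_and] at hp ⊢
  refine ⟨hp.1.1, fun b hb => ?_⟩
  obtain ⟨i, rfl⟩ := mem_parts_fibrePartition t hb
  exact hp.2 _

/-- Over a singleton block the balance condition says that a single increment vanishes, which is a
forbidden stationary step. This is how associated Stirling numbers arise in place of ordinary ones.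
-/
theorem two_le_card_of_mem_balancedPaths {V : Type*} [AddCommGroup V] [DecidableEq V]
    {Γ : Finset V} {M n : ℕ} {t : Fin M → Fin n} {p : Fin (M + 1) → Γ}
    (hp : p ∈ balancedPaths Γ t) {b : Finset (Fin M)}
    (hb : b ∈ (fibrePartition t).parts) : 2 ≤ #b := by
  simp only [balancedPaths, mem_filter, mem_univ, true_and] at hp
  have hpos := (Finpartition.nonempty_of_mem_parts _ hb).card_pos
  by_contra! hlt
  obtain ⟨j, rfl⟩ := card_eq_one.1 (show #b = 1 by omega)
  obtain ⟨i, hi⟩ := mem_parts_fibrePartition t hb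
  have h := hp.2 (t i)
  rw [← hi, sum_singleton, sub_eq_zero] at h
  exact hp.1.2 j (Subtype.ext h.symm)

theorem card_parts_mem_Icc {M : ℕ} (hM : 0 < M) {P : Finpartition (univ : Finset (Fin M))}
    (hP : ∀ b ∈ P.parts, 2 ≤ #b) : #P.parts ∈ Icc 1 (M / 2) := by
  have h1 : 0 < #P.parts := card_pos.2 ⟨_, P.part_mem.2 (mem_univ ⟨0, hM⟩)⟩
  have h2 : #P.parts * 2 ≤ M := by
    have h3 := P.sum_card_parts
    rw [card_univ, Fintype.card_fin] at h3
    exact (card_nsmul_le_sum _ _ _ hP).trans_eq h3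
  rw [mem_Icc]
  omega

/-- The total number of balanced paths is bounded through associated Stirling numbers. -/
theorem sum_card_balancedPaths_le {V : Type*} [AddCommGroup V] [DecidableEq V] (Γ : Finset V)
    {M : ℕ} (hM : 0 < M) (hΓ : Γ.Nonempty) (n : ℕ) :
    ∑ t : Fin M → Fin n, #(balancedPaths Γ t) ≤
      ∑ k ∈ Icc 1 (M / 2), assocStirling M k * (n ^ k * #Γ ^ (M + 1 - k)) := by
  classical
  let good : Finset (Finpartition (univ : Finset (Fin M))) := {P | ∀ b ∈ P.parts, 2 ≤ #b}
  calc ∑ t : Fin M → Fin n, #(balancedPaths Γ t)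
      = ∑ P : Finpartition (univ : Finset (Fin M)),
          ∑ t : Fin M → Fin n with fibrePartition t = P,
            #(balancedPaths Γ t) := (sum_fiberwise _ _ _).symm
    _ = ∑ P ∈ good, ∑ t : Fin M → Fin n with fibrePartition t = P,
            #(balancedPaths Γ t) := by
        -- Partitions with a singleton block carry no balanced paths.
        refine (sum_subset (subset_univ good) fun P _ hP => ?_).symm
        refine sum_eq_zero fun t ht => ?_
        rw [card_eq_zero, eq_empty_iff_forall_notMem]
        intro p hp
        refine hP (mem_filter.2 ⟨mem_univ _, fun b hb => ?_⟩)
        rw [← (mem_filter.1 ht).2] at hb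
        exact two_le_card_of_mem_balancedPaths hp hb
    _ ≤ ∑ P ∈ good, n ^ #P.parts * #Γ ^ (M + 1 - #P.parts) := by
        refine sum_le_sum fun P _ => ?_
        refine (sum_le_card_nsmul _ _ (#Γ ^ (M + 1 - #P.parts)) fun t ht => ?_).trans ?_
        · rw [← (mem_filter.1 ht).2]
          exact card_balancedPaths_le Γ hM hΓ t
        · rw [smul_eq_mul]
          refine Nat.mul_le_mul_right _ ((card_le_card ?_).trans (card_labelings_le P))
          intro t ht
          have ht' := (mem_filter.1 ht).2
          refine mem_filter.2 ⟨mem_univ _, fun i j hij => ?_⟩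
          rw [← ht', part_fibrePartition, part_fibrePartition] at hij
          have : i ∈ ({l | t l = t i} : Finset (Fin M)) := by simp
          rw [hij] at this
          exact (mem_filter.1 this).2
    _ = ∑ k ∈ Icc 1 (M / 2), ∑ P ∈ good with #P.parts = k,
          n ^ #P.parts * #Γ ^ (M + 1 - #P.parts) :=
        (sum_fiberwise_of_maps_to
          (fun P hP => card_parts_mem_Icc hM (mem_filter.1 hP).2) _).symm
    _ = ∑ k ∈ Icc 1 (M / 2), assocStirling M k * (n ^ k * #Γ ^ (M + 1 - k)) := by
        refine sum_congr rfl fun k _ => ?_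
        rw [sum_congr rfl (g := fun _ => n ^ k * #Γ ^ (M + 1 - k))
          (fun P hP => by rw [(mem_filter.1 hP).2]), sum_const, smul_eq_mul]
        congr 1
        rw [assocStirling, Fintype.card_subtype, filter_filter]
        exact congrArg card (filter_congr fun P _ => and_comm)

end Counting

/-! ### Orthogonality of characters on the unit cube -/

section Characters

open MeasureTheory

variable {d : ℕ}

/-- The character `y ↦ e^{2πi k·y}` of `ℝ^d`. -/
noncomputable def latticeChar (k : Fin d → ℤ) (y : Fin d → ℝ) : ℂ :=
  Complex.exp (2 * Real.pi * Complex.I * ∑ i, (k i : ℂ) * (y i : ℂ))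

theorem latticeChar_zero (y : Fin d → ℝ) : latticeChar 0 y = 1 := by
  simp [latticeChar]

theorem latticeChar_add (k l : Fin d → ℤ) (y : Fin d → ℝ) :
    latticeChar (k + l) y = latticeChar k y * latticeChar l y := by
  rw [latticeChar, latticeChar, latticeChar, ← Complex.exp_add, ← mul_add,
    ← Finset.sum_add_distrib]
  simp [add_mul]

theorem star_latticeChar (k : Fin d → ℤ) (y : Fin d → ℝ) :
    star (latticeChar k y) = latticeChar (-k) y := by
  rw [latticeChar, latticeChar, Complex.star_def, ← Complex.exp_conj]
  simp [Complex.conj_ofNat]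

theorem latticeChar_sum {ι : Type*} (s : Finset ι) (k : ι → Fin d → ℤ) (y : Fin d → ℝ) :
    latticeChar (∑ i ∈ s, k i) y = ∏ i ∈ s, latticeChar (k i) y := by
  classical
  induction s using Finset.induction_on with
  | empty => simp [latticeChar_zero]
  | insert a s ha ih => rw [Finset.sum_insert ha, Finset.prod_insert ha, latticeChar_add, ih]

theorem latticeChar_eq_prod (k : Fin d → ℤ) (y : Fin d → ℝ) :
    latticeChar k y = ∏ i, Complex.exp (2 * Real.pi * Complex.I * k i * y i) := by
  rw [latticeChar, Finset.mul_sum, Complex.exp_sum]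
  simp [mul_assoc]

theorem continuous_latticeChar (k : Fin d → ℤ) : Continuous (latticeChar k) := by
  unfold latticeChar
  fun_prop

theorem norm_latticeChar (k : Fin d → ℤ) (y : Fin d → ℝ) : ‖latticeChar k y‖ = 1 := by
  have h : latticeChar k y = Complex.exp ((2 * Real.pi * ∑ i, (k i : ℝ) * y i : ℝ) * Complex.I) := by
    rw [latticeChar]
    push_cast
    ring_nf
  rw [h, Complex.norm_exp_ofReal_mul_I]

theorem integral_Icc_exp_two_pi_I_mul (k : ℤ) :
    ∫ y in Set.Icc (0 : ℝ) 1, Complex.exp (2 * Real.pi * Complex.I * k * y) =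
      if k = 0 then 1 else 0 := by
  rw [integral_Icc_eq_integral_Ioc, ← intervalIntegral.integral_of_le zero_le_one]
  split_ifs with hk
  · simp [hk]
  · have hc : (2 * Real.pi * Complex.I * k : ℂ) ≠ 0 :=
      mul_ne_zero Complex.two_pi_I_ne_zero (by exact_mod_cast hk)
    rw [integral_exp_mul_complex hc]
    have h1 : Complex.exp (2 * Real.pi * Complex.I * k * (1 : ℝ)) = 1 :=
      Complex.exp_eq_one_iff.2 ⟨k, by push_cast; ring⟩
    rw [h1]
    simp

theorem integral_Icc_latticeChar (k : Fin d → ℤ) :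
    ∫ y in Set.Icc (0 : Fin d → ℝ) 1, latticeChar k y = if k = 0 then 1 else 0 := by
  simp only [latticeChar_eq_prod]
  have hset : Set.Icc (0 : Fin d → ℝ) 1 = Set.univ.pi fun _ => Set.Icc (0 : ℝ) 1 :=
    (Set.pi_univ_Icc 0 1).symm
  rw [hset, volume_pi, Measure.restrict_pi_pi,
    integral_fintype_prod_eq_prod fun i (u : ℝ) => Complex.exp (2 * Real.pi * Complex.I * k i * u)]
  simp only [integral_Icc_exp_two_pi_I_mul]
  rw [Finset.prod_ite_zero]
  simp [funext_iff]

theorem MeasureTheory.pdf.IsUniform.map_eq_restrict_Icc {Ω : Type*} [MeasurableSpace Ω]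
    {P : Measure Ω} {X : Ω → Fin d → ℝ} (hX : pdf.IsUniform X (Set.Icc 0 1) P) :
    P.map X = volume.restrict (Set.Icc 0 1) := by
  rw [hX, ProbabilityTheory.cond, Real.volume_Icc_pi]
  simp

theorem integral_latticeChar_of_isUniform {Ω : Type*} [MeasurableSpace Ω]
    {P : Measure Ω} {X : Ω → Fin d → ℝ} (hXm : Measurable X)
    (hX : pdf.IsUniform X (Set.Icc 0 1) P) (k : Fin d → ℤ) :
    ∫ ω, latticeChar k (X ω) ∂P = if k = 0 then 1 else 0 := by
  rw [← integral_Icc_latticeChar, ← hX.map_eq_restrict_Icc,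
    integral_map hXm.aemeasurable (continuous_latticeChar k).aestronglyMeasurable]

end Characters

/-! ### Expected trace moments -/

section Moments

open MeasureTheory

variable {d n : ℕ}

/-- All entries of `U` have modulus 1, so `n⁻¹ U* U` has unit diagonal and subtracting the identity
removes exactly the stationary steps. -/
theorem sampleMoment_sub_one_apply (hn : 1 ≤ n) (Γ : Finset (Fin d → ℤ)) (x : Fin n → Fin d → ℝ)
    (j k : Γ) : (sampleMoment Γ x - 1) j k =
      if j = k then 0 else (n : ℂ)⁻¹ * ∑ t, latticeChar ((k : Fin d → ℤ) - (j : Fin d → ℤ)) (x t) := by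
  have hS : sampleMoment Γ x j k =
      (n : ℂ)⁻¹ * ∑ t, latticeChar ((k : Fin d → ℤ) - (j : Fin d → ℤ)) (x t) := by
    rw [sampleMoment, Matrix.smul_apply, Matrix.mul_apply, smul_eq_mul]
    refine congrArg _ (Finset.sum_congr rfl fun t _ => ?_)
    rw [Matrix.conjTranspose_apply, sub_eq_neg_add, latticeChar_add, ← star_latticeChar]
    rfl
  rw [Matrix.sub_apply, hS]
  split_ifs with h
  · have hn' : (n : ℂ) ≠ 0 := by exact_mod_cast (by omega : n ≠ 0)
    subst h
    simp [latticeChar_zero, hn']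
  · rw [Matrix.one_apply_ne h, sub_zero]

/-- The trace moments of `n⁻¹ U* U - 1` as sums over paths and labellings of their steps. -/
theorem trace_sampleMoment_sub_one_pow (hn : 1 ≤ n) (Γ : Finset (Fin d → ℤ))
    (x : Fin n → Fin d → ℝ) (M : ℕ) :
    ((sampleMoment Γ x - 1) ^ M).trace =
      ∑ p : Fin (M + 1) → Γ with
        p 0 = p (Fin.last M) ∧ ∀ i : Fin M, p i.castSucc ≠ p i.succ,
      ∑ t : Fin M → Fin n, ((n : ℂ)⁻¹) ^ M * ∏ s,
        latticeChar (∑ i with t i = s, ((p i.succ : Fin d → ℤ) - (p i.castSucc : Fin d → ℤ))) (x s) := by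
  rw [Matrix.trace_pow_eq_sum_closed_paths, ← Finset.filter_filter,
    Finset.sum_filter (p := fun p : Fin (M + 1) → Γ => ∀ i : Fin M, p i.castSucc ≠ p i.succ)]
  refine Finset.sum_congr rfl fun p _ => ?_
  simp only [sampleMoment_sub_one_apply hn]
  split_ifs with h
  · rw [Finset.prod_congr rfl fun i _ => if_neg (h i), Finset.prod_mul_distrib,
      Finset.prod_const, Finset.card_univ, Fintype.card_fin, Finset.prod_univ_sum,
      Fintype.piFinset_univ, Finset.mul_sum]
    refine Finset.sum_congr rfl fun t _ => congrArg _ ?_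
    -- Grouping the steps by sample collects the increments of each fibre into one frequency per
    -- variable `x s`, ready for independence.
    rw [← Finset.prod_fiberwise Finset.univ t]
    refine Finset.prod_congr rfl fun s _ => ?_
    rw [latticeChar_sum]
    exact Finset.prod_congr rfl fun i hi => by rw [(Finset.mem_filter.1 hi).2]
  · push Not at h
    obtain ⟨i, hi⟩ := h
    exact Finset.prod_eq_zero (Finset.mem_univ i) (if_pos hi)

variable {Ω : Type*} [MeasurableSpace Ω] {P : Measure Ω} {x : Fin n → Ω → Fin d → ℝ}

theorem integrable_prod_latticeChar [IsProbabilityMeasure P]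
    (hx : ∀ t, Measurable (x t)) (k : Fin n → Fin d → ℤ) :
    Integrable (fun ω => ∏ s, latticeChar (k s) (x s ω)) P := by
  refine Integrable.of_bound (C := 1) ?_ (Filter.Eventually.of_forall fun ω => ?_)
  · exact (Finset.measurable_fun_prod _ fun s _ =>
      (continuous_latticeChar (k s)).measurable.comp (hx s)).aestronglyMeasurable
  · simp [norm_prod, norm_latticeChar]

theorem integral_prod_latticeChar (hx : ∀ t, Measurable (x t))
    (hind : ProbabilityTheory.iIndepFun x P)
    (hunif : ∀ t, pdf.IsUniform (x t) (Set.Icc 0 1) P) (k : Fin n → Fin d → ℤ) :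
    ∫ ω, ∏ s, latticeChar (k s) (x s ω) ∂P = if ∀ s, k s = 0 then 1 else 0 := by
  rw [hind.integral_fun_prod_comp (fun s => (hx s).aemeasurable)
    (fun s => (continuous_latticeChar (k s)).aestronglyMeasurable)]
  simp only [fun s => integral_latticeChar_of_isUniform (hx s) (hunif s)]
  rw [Finset.prod_ite_zero]
  simp

theorem integrable_trace_sampleMoment [IsProbabilityMeasure P] (hn : 1 ≤ n)
    (Γ : Finset (Fin d → ℤ))
    (hx : ∀ t, Measurable (x t)) (M : ℕ) :
    Integrable (fun ω => ((sampleMoment Γ (fun t => x t ω) - 1) ^ M).trace) P := by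
  simp only [trace_sampleMoment_sub_one_pow hn]
  exact integrable_finsetSum _ fun p _ => integrable_finsetSum _ fun t _ =>
    (integrable_prod_latticeChar hx _).const_mul _

theorem integral_trace_sampleMoment [IsProbabilityMeasure P] (hn : 1 ≤ n)
    (Γ : Finset (Fin d → ℤ))
    (hx : ∀ t, Measurable (x t)) (hind : ProbabilityTheory.iIndepFun x P)
    (hunif : ∀ t, pdf.IsUniform (x t) (Set.Icc 0 1) P) (M : ℕ) :
    ∫ ω, ((sampleMoment Γ (fun t => x t ω) - 1) ^ M).trace ∂P =
      ((n : ℂ)⁻¹) ^ M * ((∑ t : Fin M → Fin n, (balancedPaths Γ t).card : ℕ) : ℂ) := by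
  simp only [trace_sampleMoment_sub_one_pow hn]
  rw [integral_finsetSum _ fun p _ => integrable_finsetSum _ fun t _ =>
    (integrable_prod_latticeChar hx _).const_mul _]
  simp only [fun p : Fin (M + 1) → Γ => integral_finsetSum (μ := P) Finset.univ
    fun (t : Fin M → Fin n) _ => (integrable_prod_latticeChar (P := P) hx fun s =>
      ∑ i with t i = s, ((p i.succ : Fin d → ℤ) - (p i.castSucc : Fin d → ℤ))).const_mul (((n : ℂ)⁻¹) ^ M)]
  simp only [integral_const_mul, integral_prod_latticeChar hx hind hunif]
  rw [Finset.sum_comm, Nat.cast_sum, Finset.mul_sum]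
  refine Finset.sum_congr rfl fun t _ => ?_
  rw [← Finset.mul_sum, Finset.sum_boole, Finset.filter_filter]
  rfl

/-- Termwise this is the rescaling `n^(k-M) D^(M+1-k) = D (n/D)^(k-M)`, which makes `n/D` the only
parameter besides the factor `D`. -/
theorem inv_pow_mul_stirling_sum {D : ℕ} (hn : 1 ≤ n) (hD : 1 ≤ D) (M : ℕ) :
    ((n : ℝ)⁻¹) ^ M * ((∑ k ∈ Finset.Icc 1 (M / 2),
      assocStirling M k * (n ^ k * D ^ (M + 1 - k)) : ℕ) : ℝ) =
      D * stirlingG M ((n : ℝ) / D) := by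
  have hn' : (n : ℝ) ≠ 0 := by exact_mod_cast (by omega : n ≠ 0)
  have hD' : (D : ℝ) ≠ 0 := by exact_mod_cast (by omega : D ≠ 0)
  rw [stirlingG, stirlingF, Polynomial.eval_finsetSum, Nat.cast_sum, Finset.mul_sum,
    Finset.mul_sum, Finset.mul_sum]
  refine Finset.sum_congr rfl fun k hk => ?_
  have hkM : k ≤ M + 1 := by rw [Finset.mem_Icc] at hk; omega
  have hpow : (D : ℝ) ^ (M + 1) = D ^ (M + 1 - k) * D ^ k := by
    rw [← pow_add, Nat.sub_add_cancel hkM]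
  simp only [Polynomial.eval_mul, Polynomial.eval_C, Polynomial.eval_pow, Polynomial.eval_X,
    zpow_neg, zpow_natCast, div_pow, inv_pow]
  push_cast
  field_simp
  rw [mul_assoc, mul_assoc, ← hpow, pow_succ']

theorem integral_re_trace_sampleMoment_le [IsProbabilityMeasure P] (hn : 1 ≤ n)
    (Γ : Finset (Fin d → ℤ))
    (hΓ : Γ.Nonempty) (hx : ∀ t, Measurable (x t)) (hind : ProbabilityTheory.iIndepFun x P)
    (hunif : ∀ t, pdf.IsUniform (x t) (Set.Icc 0 1) P) {M : ℕ} (hM : 0 < M) :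
    ∫ ω, (((sampleMoment Γ (fun t => x t ω) - 1) ^ M).trace).re ∂P ≤
      Γ.card * stirlingG M ((n : ℝ) / Γ.card) := by
  have h : ∫ ω, (((sampleMoment Γ (fun t => x t ω) - 1) ^ M).trace).re ∂P =
      (∫ ω, ((sampleMoment Γ (fun t => x t ω) - 1) ^ M).trace ∂P).re :=
    integral_re (integrable_trace_sampleMoment hn Γ hx M)
  rw [h, integral_trace_sampleMoment hn Γ hx hind hunif]
  have hcast : (((n : ℂ)⁻¹) ^ M * ((∑ t : Fin M → Fin n, (balancedPaths Γ t).card : ℕ) : ℂ)) =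
      ((((n : ℝ)⁻¹) ^ M * ((∑ t : Fin M → Fin n, (balancedPaths Γ t).card : ℕ) : ℝ) : ℝ) : ℂ) := by
    push_cast
    rfl
  rw [hcast, Complex.ofReal_re, ← inv_pow_mul_stirling_sum hn hΓ.card_pos]
  have hc := sum_card_balancedPaths_le Γ hM hΓ n
  gcongr

end Moments

/-! ### The tail bound -/

theorem mainTheorem2 {Ω : Type*} [MeasurableSpace Ω]
    (P : MeasureTheory.Measure Ω) [MeasureTheory.IsProbabilityMeasure P]
    (d n : ℕ) (hn : 1 ≤ n) (Γ : Finset (Fin d → ℤ)) [Nonempty Γ] (D : ℕ) (hD : Γ.card = D)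
    (x : Fin n → Ω → (Fin d → ℝ)) (hx_meas : ∀ t, Measurable (x t))
    (hx_indep : ProbabilityTheory.iIndepFun x P)
    (hx_unif : ∀ t, MeasureTheory.pdf.IsUniform (x t) (Set.Icc 0 1) P)
    (ε : ℝ) (hε : 0 < ε) (m : ℕ) (hm : 1 ≤ m) :
    1 - ε ^ (-(2 * m : ℤ)) * (D : ℝ) * stirlingG (2 * m) ((n : ℝ) / (D : ℝ)) ≤
      P.real {ω |
        ‖sampleMoment Γ (fun t => x t ω) - 1‖ < ε ∧
        1 - ε < lambdaMin (sampleMoment_isHermitian Γ (fun t => x t ω)) ∧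
        lambdaMin (sampleMoment_isHermitian Γ (fun t => x t ω)) ≤
          lambdaMax (sampleMoment_isHermitian Γ (fun t => x t ω)) ∧
        lambdaMax (sampleMoment_isHermitian Γ (fun t => x t ω)) < 1 + ε} := by
  subst hD
  have hΓ : Γ.Nonempty := Finset.nonempty_coe_sort.1 ‹_›
  set f : Ω → ℝ := fun ω => (((sampleMoment Γ (fun t => x t ω) - 1) ^ (2 * m)).trace).re with hf
  have hnorm : ∀ ω, ‖sampleMoment Γ (fun t => x t ω) - 1‖ ^ (2 * m) ≤ f ω := fun ω =>
    ((sampleMoment_isHermitian Γ (fun t => x t ω)).sub Matrix.isHermitian_one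
      ).norm_pow_le_re_trace_pow m
  have hf0 : ∀ ω, 0 ≤ f ω := fun ω => le_trans (by positivity) (hnorm ω)
  have hfint : MeasureTheory.Integrable f P :=
    (integrable_trace_sampleMoment hn Γ hx_meas (2 * m)).re
  have hε' : 0 < ε ^ (2 * m) := pow_pos hε _
  -- Markov's inequality is applied to the trace, whose integrability is known, and not to the norm
  -- that it dominates.
  have hmarkov := MeasureTheory.mul_meas_ge_le_integral_of_nonneg
    (Filter.Eventually.of_forall hf0) hfint (ε ^ (2 * m))
  have hbound := integral_re_trace_sampleMoment_le (P := P) hn Γ hΓ hx_meas hx_indep hx_unif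
    (M := 2 * m) (by omega)
  set E : Set Ω := {ω | ε ^ (2 * m) ≤ f ω} with hE
  have hEnull : MeasureTheory.NullMeasurableSet E P :=
    nullMeasurableSet_le aemeasurable_const hfint.aemeasurable
  have hcompl : P.real Eᶜ = 1 - P.real E := by
    rw [MeasureTheory.measureReal_compl₀ hEnull, MeasureTheory.probReal_univ]
  have hPE : P.real E ≤ ε ^ (-(2 * m : ℤ)) * (Γ.card : ℝ) *
      stirlingG (2 * m) ((n : ℝ) / (Γ.card : ℝ)) := by
    have hz : ε ^ (-(2 * m : ℤ)) = (ε ^ (2 * m))⁻¹ := by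
      rw [zpow_neg]
      norm_cast
    rw [hz, mul_assoc, inv_mul_eq_div, le_div_iff₀ hε', mul_comm]
    exact hmarkov.trans hbound
  calc _ ≤ 1 - P.real E := by linarith
    _ = P.real Eᶜ := hcompl.symm
    _ ≤ _ := by
      -- Off `E` the norm is below `ε`, and the eigenvalue bounds follow pointwise. Only
      -- monotonicity of the measure is used, so measurability of the target event is not needed.
      refine MeasureTheory.measureReal_mono fun ω hω => ?_
      have hlt : f ω < ε ^ (2 * m) := not_le.1 hω
      have hA : ‖sampleMoment Γ (fun t => x t ω) - 1‖ < ε :=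
        lt_of_pow_lt_pow_left₀ _ hε.le ((hnorm ω).trans_lt hlt)
      exact ⟨hA, one_sub_lt_lambdaMin _ hA, lambdaMin_le_lambdaMax _, lambdaMax_lt_one_add _ hA⟩
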